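/- For $|q|<1$ let $\varphi(q)=\sum_{n=-\infty}^{\infty}q^{n^2}$. Then $$\varphi(e^{-5\pi\sqrt5}) = 5^{-3/4}\,\varphi(e^{-\pi\sqrt5})\left\{1+\left(\frac{2\left(1+\tan\frac{\pi}{5}\right)}{1-\sin\frac{\pi}{5}}\right)^{1/5}+\left(\frac{2\left(1-\tan\frac{\pi}{5}\right)}{1+\sin\frac{\pi}{5}}\right)^{1/5}\right\},$$ where the fifth roots are the real positive ones. -/

import Mathlib

/-- Ramanujan's theta function `φ(q) = ∑_{n ∈ ℤ} q^(n²)`, for real `q` with `|q| < 1`. -/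
noncomputable def ramanujanPhi (q : ℝ) : ℝ := ∑' n : ℤ, q ^ (n ^ 2)

/-- The series that defines `φ(q)` converges (absolutely) when `|q| < 1`. -/
theorem summable_ramanujanPhi {q : ℝ} (hq : |q| < 1) :
    Summable fun n : ℤ => q ^ (n ^ 2) := by
  have h : Summable fun n : ℕ => q ^ (n ^ 2) := by
    refine Summable.of_norm_bounded (g := fun n : ℕ => |q| ^ n)
      (summable_geometric_of_lt_one (abs_nonneg q) hq) fun n => ?_
    rw [norm_pow, Real.norm_eq_abs]
    exact pow_le_pow_of_le_one (abs_nonneg q) hq.le (Nat.le_self_pow two_ne_zero n)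
  have h' : Summable fun n : ℕ => q ^ ((n : ℤ) ^ 2) := by
    refine h.congr fun n => ?_
    rw [← zpow_natCast]
    push_cast
    rfl
  refine Summable.of_nat_of_neg h' ?_
  simpa only [neg_sq] using h'

/-! Put x = exp(-π/(5√5)). Theta inversion turns the left side into 5^(-3/4) φ(x). Sorting indices
modulo 5 gives φ(x) = t₀ + 2t₁ + 2t₂ with t₀ = φ(x^25) = φ(exp(-π√5)), so the bracket is 1 + m + n
with m = 2t₁/t₀ and n = 2t₂/t₀. Two relations determine m and n. Inversion at √5 gives φ(x^5)² = √5
t₀², so `ramanujanPhi_pow_five_sq` yields mn = √5 - 1. Then `thetaResidue_five_sextic` yields m^5 +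
n^5. Thus m^5 and n^5 are the roots of a known quadratic, whose roots are also the two trigonometric
radicands. -/

/-- The partial theta series `∑_{n ∈ ℤ} q^((N n + c)²)` over the residue class of `c` modulo `N`. -/
noncomputable def thetaResidue (q : ℝ) (N c : ℤ) : ℝ := ∑' n : ℤ, q ^ ((N * n + c) ^ 2)

theorem summable_thetaResidue {q : ℝ} (hq : |q| < 1) {N : ℤ} (hN : N ≠ 0) (c : ℤ) :
    Summable fun n : ℤ => q ^ ((N * n + c) ^ 2) := by
  refine (summable_ramanujanPhi hq).comp_injective (i := fun n : ℤ => N * n + c) fun a b h => ?_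
  exact mul_left_cancel₀ hN (add_right_cancel h)

theorem thetaResidue_neg (q : ℝ) (N c : ℤ) : thetaResidue q N (-c) = thetaResidue q N c := by
  unfold thetaResidue
  rw [← (Equiv.neg ℤ).tsum_eq]
  refine tsum_congr fun n => ?_
  congr 1
  simp only [Equiv.neg_apply]
  ring

theorem thetaResidue_add_self (q : ℝ) (N c : ℤ) :
    thetaResidue q N (c + N) = thetaResidue q N c := by
  unfold thetaResidue
  rw [← (Equiv.addRight (1 : ℤ)).tsum_eq fun n : ℤ => q ^ ((N * n + c) ^ 2)]
  refine tsum_congr fun n => ?_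
  congr 1
  simp only [Equiv.coe_addRight]
  ring

theorem thetaResidue_sub (q : ℝ) (N c : ℤ) : thetaResidue q N (N - c) = thetaResidue q N c := by
  rw [← thetaResidue_neg q N c, ← thetaResidue_add_self q N (-c), neg_add_eq_sub]

theorem thetaResidue_pos {q : ℝ} (hq₀ : 0 < q) (hq : |q| < 1) {N : ℤ} (hN : N ≠ 0) (c : ℤ) :
    0 < thetaResidue q N c :=
  (summable_thetaResidue hq hN c).tsum_pos (fun _ => (zpow_pos hq₀ _).le) 0 (zpow_pos hq₀ _)

theorem thetaResidue_mul {q : ℝ} (hq₀ : 0 < q) (hq : |q| < 1) {N : ℤ} (hN : N ≠ 0) (c d : ℤ) :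
    (Summable fun p : ℤ × ℤ => q ^ ((N * p.1 + c) ^ 2 + (N * p.2 + d) ^ 2)) ∧
      thetaResidue q N c * thetaResidue q N d =
        ∑' p : ℤ × ℤ, q ^ ((N * p.1 + c) ^ 2 + (N * p.2 + d) ^ 2) := by
  have hc := (summable_thetaResidue hq hN c).norm
  have hd := (summable_thetaResidue hq hN d).norm
  simp only [zpow_add₀ hq₀.ne']
  exact ⟨summable_mul_of_summable_norm (f := fun n : ℤ => q ^ ((N * n + c) ^ 2))
      (g := fun n : ℤ => q ^ ((N * n + d) ^ 2)) hc hd,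
    tsum_mul_tsum_of_summable_norm (f := fun n : ℤ => q ^ ((N * n + c) ^ 2))
      (g := fun n : ℤ => q ^ ((N * n + d) ^ 2)) hc hd⟩

theorem ramanujanPhi_eq_thetaResidue (q : ℝ) : ramanujanPhi q = thetaResidue q 1 0 := by
  simp [ramanujanPhi, thetaResidue]

theorem ramanujanPhi_pow_sq (q : ℝ) (k : ℕ) :
    ramanujanPhi (q ^ (k ^ 2)) = thetaResidue q k 0 := by
  refine tsum_congr fun n => ?_
  rw [← zpow_natCast, ← zpow_mul]
  congr 1
  push_cast
  ring

theorem tsum_eq_sum_tsum_of_equiv {ι α β : Type*} [Fintype ι] (e : ι × α ≃ β) {f : β → ℝ}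
    (hf : Summable f) : ∑' b, f b = ∑ i, ∑' a, f (e (i, a)) := by
  have hs : Summable fun p : ι × α => f (e p) := e.summable_iff.2 hf
  rw [← e.tsum_eq f, hs.tsum_prod, tsum_fintype]

/-- Splitting `φ(q)` according to the residue of the summation index modulo `5`. -/
theorem ramanujanPhi_eq_five_dissection {q : ℝ} (hq : |q| < 1) :
    ramanujanPhi q =
      thetaResidue q 5 0 + 2 * thetaResidue q 5 1 + 2 * thetaResidue q 5 2 := by
  have h3 : thetaResidue q 5 3 = thetaResidue q 5 2 := thetaResidue_sub q 5 2
  have h4 : thetaResidue q 5 4 = thetaResidue q 5 1 := thetaResidue_sub q 5 1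
  have key : ramanujanPhi q = ∑ i : Fin 5, thetaResidue q 5 (i : ℕ) := by
    rw [ramanujanPhi, tsum_eq_sum_tsum_of_equiv
      ((Equiv.prodComm (Fin 5) ℤ).trans (Int.divModEquiv 5).symm) (summable_ramanujanPhi hq)]
    refine Finset.sum_congr rfl fun i _ => tsum_congr fun n => ?_
    congr 2
    simp [Int.divModEquiv, mul_comm, add_comm]
  rw [key]
  simp only [Fin.sum_univ_five]
  norm_num
  rw [h3, h4]
  ring

/-! ### Product identities for theta constants -/

/-- Pairs of integers, sorted by the parity of the sum of the two entries. -/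
def sumDiffEquiv : Fin 2 × ℤ × ℤ ≃ ℤ × ℤ where
  toFun p := (p.2.1 + p.2.2 + (p.1 : ℕ), p.2.1 - p.2.2)
  invFun m := (⟨((m.1 + m.2) % 2).toNat, by omega⟩, (m.1 + m.2) / 2, (m.1 - m.2) / 2)
  left_inv := by
    rintro ⟨i, s, t⟩
    have := i.isLt
    ext <;> simp <;> omega
  right_inv := by
    rintro ⟨m, n⟩
    ext <;> simp <;> omega

/-- Pairs `(m, n)` of integers, sorted by the residue of `m + 2 n` modulo `5`; the pair with
coordinates `(i, s, t)` satisfies `m + 2 n = 5 s + i` and `2 m - n = 5 t + 2 i`. -/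
def gaussFiveEquiv : Fin 5 × ℤ × ℤ ≃ ℤ × ℤ where
  toFun p := (p.2.1 + 2 * p.2.2 + (p.1 : ℕ), 2 * p.2.1 - p.2.2)
  invFun m := (⟨((m.1 + 2 * m.2) % 5).toNat, by omega⟩, (m.1 + 2 * m.2) / 5,
    (2 * m.1 - m.2 - 2 * ((m.1 + 2 * m.2) % 5)) / 5)
  left_inv := by
    rintro ⟨i, s, t⟩
    have := i.isLt
    ext <;> simp <;> omega
  right_inv := by
    rintro ⟨m, n⟩
    ext <;> simp <;> omega

/-- From 2(a² + b²) = (a + b)² + (a - b)²; the two terms are the two parities of the sum of the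
indices. -/
theorem thetaResidue_mul_eq_sum_diff {q : ℝ} (hq₀ : 0 < q) (hq : |q| < 1) (c d : ℤ) :
    thetaResidue (q ^ 2) 5 c * thetaResidue (q ^ 2) 5 d =
      thetaResidue q 10 (c + d) * thetaResidue q 10 (c - d) +
        thetaResidue q 10 (c + d + 5) * thetaResidue q 10 (c - d + 5) := by
  have hq2 : |q ^ 2| < 1 := by
    rw [abs_pow]; exact pow_lt_one₀ (abs_nonneg q) hq two_ne_zero
  obtain ⟨hs, h⟩ := thetaResidue_mul (pow_pos hq₀ 2) hq2 (N := 5) (by norm_num) c d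
  rw [h, tsum_eq_sum_tsum_of_equiv sumDiffEquiv hs, Fin.sum_univ_two,
    (thetaResidue_mul hq₀ hq (N := 10) (by norm_num) _ _).2,
    (thetaResidue_mul hq₀ hq (N := 10) (by norm_num) _ _).2]
  congr 1 <;> refine tsum_congr fun p => ?_ <;> rw [← zpow_natCast q 2, ← zpow_mul] <;>
    congr 1 <;> simp [sumDiffEquiv] <;> ring

/-- From 5(m² + n²) = (m + 2n)² + (2m - n)². The residues are i and 2i modulo 5; each nonzero i
contributes the same product. -/
theorem ramanujanPhi_pow_five_sq {q : ℝ} (hq₀ : 0 < q) (hq : |q| < 1) :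
    ramanujanPhi (q ^ 5) ^ 2 =
      thetaResidue q 5 0 ^ 2 + 4 * (thetaResidue q 5 1 * thetaResidue q 5 2) := by
  have hq5 : |q ^ 5| < 1 := by
    rw [abs_pow]; exact pow_lt_one₀ (abs_nonneg q) hq (by norm_num)
  obtain ⟨hs, h⟩ := thetaResidue_mul (pow_pos hq₀ 5) hq5 (N := 1) (by norm_num) 0 0
  have key : ramanujanPhi (q ^ 5) ^ 2 =
      ∑ i : Fin 5, thetaResidue q 5 (i : ℕ) * thetaResidue q 5 (2 * (i : ℕ)) := by
    rw [ramanujanPhi_eq_thetaResidue, sq, h,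
      tsum_eq_sum_tsum_of_equiv gaussFiveEquiv hs]
    refine Finset.sum_congr rfl fun i _ => ?_
    rw [(thetaResidue_mul hq₀ hq (N := 5) (by norm_num) _ _).2]
    refine tsum_congr fun p => ?_
    rw [← zpow_natCast q 5, ← zpow_mul]
    congr 1
    simp [gaussFiveEquiv]
    ring
  have h3 : thetaResidue q 5 3 = thetaResidue q 5 2 := thetaResidue_sub q 5 2
  have h4 : thetaResidue q 5 4 = thetaResidue q 5 1 := thetaResidue_sub q 5 1
  have h6 : thetaResidue q 5 6 = thetaResidue q 5 1 := thetaResidue_add_self q 5 1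
  have h8 : thetaResidue q 5 8 = thetaResidue q 5 2 := (thetaResidue_add_self q 5 3).trans h3
  rw [key]
  simp only [Fin.sum_univ_five]
  norm_num
  rw [h3, h4, h6, h8]
  ring

/-- The sextic relation between the three theta constants of level five. It says that the
symmetric matrix of their pairwise products, which is a sum of two matrices of rank one,
is singular. -/
theorem thetaResidue_five_sextic {q : ℝ} (hq₀ : 0 < q) (hq : |q| < 1) :
    thetaResidue q 5 0 * (thetaResidue q 5 1 ^ 5 + thetaResidue q 5 2 ^ 5) =
      thetaResidue q 5 0 ^ 4 * (thetaResidue q 5 1 * thetaResidue q 5 2) -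
        thetaResidue q 5 0 ^ 2 * (thetaResidue q 5 1 * thetaResidue q 5 2) ^ 2 +
        2 * (thetaResidue q 5 1 * thetaResidue q 5 2) ^ 3 := by
  obtain ⟨y, hy₀, rfl⟩ : ∃ y : ℝ, 0 < y ∧ y ^ 2 = q :=
    ⟨√q, Real.sqrt_pos.2 hq₀, Real.sq_sqrt hq₀.le⟩
  have hy : |y| < 1 := by
    rw [abs_pow] at hq
    exact (pow_lt_one_iff_of_nonneg (abs_nonneg y) two_ne_zero).1 hq
  have h00 := thetaResidue_mul_eq_sum_diff hy₀ hy 0 0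
  have h11 := thetaResidue_mul_eq_sum_diff hy₀ hy 1 1
  have h22 := thetaResidue_mul_eq_sum_diff hy₀ hy 2 2
  have h20 := thetaResidue_mul_eq_sum_diff hy₀ hy 2 0
  have h21 := thetaResidue_mul_eq_sum_diff hy₀ hy 2 1
  have h10 := thetaResidue_mul_eq_sum_diff hy₀ hy 1 0
  have g6 : thetaResidue y 10 6 = thetaResidue y 10 4 := thetaResidue_sub y 10 4
  have g7 : thetaResidue y 10 7 = thetaResidue y 10 3 := thetaResidue_sub y 10 3
  have g8 : thetaResidue y 10 8 = thetaResidue y 10 2 := thetaResidue_sub y 10 2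
  have g9 : thetaResidue y 10 9 = thetaResidue y 10 1 := thetaResidue_sub y 10 1
  norm_num [g6, g7, g8, g9] at h00 h11 h22 h20 h21 h10
  generalize thetaResidue (y ^ 2) 5 0 = t₀ at *
  generalize thetaResidue (y ^ 2) 5 1 = t₁ at *
  generalize thetaResidue (y ^ 2) 5 2 = t₂ at *
  generalize thetaResidue y 10 0 = e₀ at *
  generalize thetaResidue y 10 1 = e₁ at *
  generalize thetaResidue y 10 2 = e₂ at *
  generalize thetaResidue y 10 3 = e₃ at *
  generalize thetaResidue y 10 4 = e₄ at *
  generalize thetaResidue y 10 5 = e₅ at *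
  -- The matrix has rows (t₀², t₁², t₂²), (t₁², t₂t₀, t₂t₁), (t₂², t₂t₁, t₁t₀). It equals uuᵀ + vvᵀ
  -- with u = (e₀, e₂, e₄) and v = (e₅, e₃, e₁), so its rank is at most 2.
  have hdet : (t₀ * t₀) * ((t₂ * t₀) * (t₁ * t₀) - (t₂ * t₁) * (t₂ * t₁)) -
      (t₁ * t₁) * ((t₁ * t₁) * (t₁ * t₀) - (t₂ * t₁) * (t₂ * t₂)) +
      (t₂ * t₂) * ((t₁ * t₁) * (t₂ * t₁) - (t₂ * t₀) * (t₂ * t₂)) = 0 := by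
    rw [h00, h11, h22, h20, h21, h10]
    ring
  linear_combination -hdet

/-! ### Inversion and the closed form -/

theorem ramanujanPhi_exp_inv {a : ℝ} (ha : 0 < a) :
    ramanujanPhi (Real.exp (-(Real.pi * a))) =
      1 / a ^ (1 / 2 : ℝ) * ramanujanPhi (Real.exp (-(Real.pi / a))) := by
  have h (b : ℝ) : ramanujanPhi (Real.exp (-b)) = ∑' n : ℤ, Real.exp (-b * (n : ℝ) ^ 2) := by
    refine tsum_congr fun n => ?_
    rw [← Real.rpow_intCast, ← Real.exp_mul]
    push_cast
    ring_nf
  rw [h, h]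
  convert Real.tsum_exp_neg_mul_int_sq ha using 4 <;> ring_nf

/-- Sum and product fix an unordered pair, so it need not be known which of m, n matches which
radicand. -/
theorem fifth_root_pair_add {m n X Y : ℝ} (hm : 0 ≤ m) (hn : 0 ≤ n)
    (hadd : m ^ 5 + n ^ 5 = X + Y) (hmul : m ^ 5 * n ^ 5 = X * Y) :
    X ^ (1 / 5 : ℝ) + Y ^ (1 / 5 : ℝ) = m + n := by
  have root {a : ℝ} (ha : 0 ≤ a) : (a ^ 5) ^ (1 / 5 : ℝ) = a := by
    rw [← Real.rpow_natCast, ← Real.rpow_mul ha]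
    norm_num
  have hY : Y = m ^ 5 + n ^ 5 - X := by linarith
  have hX : (X - m ^ 5) * (X - n ^ 5) = 0 := by
    subst hY
    linear_combination hmul
  rcases mul_eq_zero.1 hX with h | h
  · obtain rfl : X = m ^ 5 := by linarith
    obtain rfl : Y = n ^ 5 := by linarith
    rw [root hm, root hn]
  · obtain rfl : X = n ^ 5 := by linarith
    obtain rfl : Y = m ^ 5 := by linarith
    rw [root hm, root hn, add_comm]

theorem tan_sin_pi_div_five_add_and_mul :
    2 * (1 + Real.tan (Real.pi / 5)) / (1 - Real.sin (Real.pi / 5)) +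
      2 * (1 - Real.tan (Real.pi / 5)) / (1 + Real.sin (Real.pi / 5)) = 20 * √5 - 36 ∧
    2 * (1 + Real.tan (Real.pi / 5)) / (1 - Real.sin (Real.pi / 5)) *
      (2 * (1 - Real.tan (Real.pi / 5)) / (1 + Real.sin (Real.pi / 5))) = (√5 - 1) ^ 5 := by
  have h5 : √5 ^ 2 = (5 : ℝ) := Real.sq_sqrt (by norm_num)
  have hs : Real.sin (Real.pi / 5) ^ 2 = 1 - ((1 + √5) / 4) ^ 2 := by
    rw [Real.sin_sq, Real.cos_pi_div_five]
  have hk : 0 < 1 + √5 := by positivity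
  rw [Real.tan_eq_sin_div_cos, Real.cos_pi_div_five]
  generalize Real.sin (Real.pi / 5) = s at *
  generalize √5 = r at *
  have h1 : 1 - s ≠ 0 := fun h => by nlinarith
  have h2 : 1 + s ≠ 0 := fun h => by nlinarith
  have hr : 1 + r ≠ 0 := hk.ne'
  have hs' : s ^ 2 = (5 - r) / 8 := by rw [hs]; linear_combination -h5 / 16
  -- Since r² = 5, the reciprocal of (1 + r)/4 is r - 1.
  have hinv : s / ((1 + r) / 4) = s * (r - 1) := by
    field_simp
    linear_combination -s * h5
  rw [hinv]
  constructor
  · rw [div_add_div _ _ h1 h2, div_eq_iff (mul_ne_zero h1 h2)]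
    linear_combination (24 * r - 40) * hs' - 3 * h5
  · have hp : (r - 1) ^ 5 = 80 * r - 176 := by
      linear_combination (r ^ 3 - 5 * r ^ 2 + 15 * r - 35) * h5
    have hp2 : (r - 1) ^ 2 = 6 - 2 * r := by linear_combination h5
    rw [hp, div_mul_div_comm, div_eq_iff (mul_ne_zero h1 h2)]
    linear_combination (88 * r - 200) * hs' - 11 * h5 - 4 * s ^ 2 * hp2

theorem corollary5p4 :
    ramanujanPhi (Real.exp (-(5 * Real.pi * √5))) =
      (5 : ℝ) ^ (-(3 / 4) : ℝ) * ramanujanPhi (Real.exp (-(Real.pi * √5))) *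
        (1 + (2 * (1 + Real.tan (Real.pi / 5)) / (1 - Real.sin (Real.pi / 5))) ^ (1 / 5 : ℝ)
          + (2 * (1 - Real.tan (Real.pi / 5)) / (1 + Real.sin (Real.pi / 5))) ^ (1 / 5 : ℝ)) := by
  have h5 : √5 ^ 2 = (5 : ℝ) := Real.sq_sqrt (by norm_num)
  have hr : 0 < √5 := by positivity
  -- Inversion pairs x with the left-hand nome, and x^5 with x^25.
  set x : ℝ := Real.exp (-(Real.pi / (5 * √5))) with hx
  have hx₀ : 0 < x := Real.exp_pos _
  have hx₁ : |x| < 1 := by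
    rw [abs_of_pos hx₀, hx, Real.exp_lt_one_iff]
    have := Real.pi_pos
    have : 0 < Real.pi / (5 * √5) := by positivity
    linarith
  have hx5 : Real.exp (-(Real.pi / √5)) = x ^ 5 := by
    rw [hx, ← Real.exp_nat_mul]
    congr 1
    field_simp
    norm_num
  have hx25 : Real.exp (-(Real.pi * √5)) = x ^ (5 ^ 2) := by
    rw [hx, ← Real.exp_nat_mul]
    congr 1
    field_simp
    norm_num [h5]
  have hlhs : ramanujanPhi (Real.exp (-(5 * Real.pi * √5))) =
      (5 : ℝ) ^ (-(3 / 4) : ℝ) * ramanujanPhi x := by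
    have h := ramanujanPhi_exp_inv (a := 5 * √5) (by positivity)
    rw [← hx] at h
    rw [show 5 * Real.pi * √5 = Real.pi * (5 * √5) by ring, h]
    congr 1
    rw [Real.sqrt_eq_rpow, ← Real.rpow_one_add' (by norm_num) (by norm_num),
      ← Real.rpow_mul (by norm_num), one_div, ← Real.rpow_neg (by norm_num)]
    norm_num
  have hquot : ramanujanPhi (x ^ 5) ^ 2 = √5 * ramanujanPhi (x ^ (5 ^ 2)) ^ 2 := by
    have h := ramanujanPhi_exp_inv hr
    rw [hx5, hx25, ← Real.sqrt_eq_rpow] at h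
    rw [h, mul_pow, div_pow, Real.sq_sqrt hr.le]
    field_simp
  have hphi := ramanujanPhi_eq_five_dissection hx₁
  have hsq := ramanujanPhi_pow_five_sq hx₀ hx₁
  have hsext := thetaResidue_five_sextic hx₀ hx₁
  have hT : ramanujanPhi (x ^ (5 ^ 2)) = thetaResidue x 5 0 := by
    simpa only [Nat.cast_ofNat] using ramanujanPhi_pow_sq x 5
  have p₀ := thetaResidue_pos hx₀ hx₁ (N := 5) (by norm_num) 0
  have p₁ := thetaResidue_pos hx₀ hx₁ (N := 5) (by norm_num) 1
  have p₂ := thetaResidue_pos hx₀ hx₁ (N := 5) (by norm_num) 2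
  rw [hlhs, hx25, hphi, hT]
  rw [hquot, hT] at hsq
  generalize thetaResidue x 5 0 = t₀ at *
  obtain ⟨m, hm⟩ : ∃ m, m = 2 * thetaResidue x 5 1 / t₀ := ⟨_, rfl⟩
  obtain ⟨n, hn⟩ : ∃ n, n = 2 * thetaResidue x 5 2 / t₀ := ⟨_, rfl⟩
  have e₁ : thetaResidue x 5 1 = m * t₀ / 2 := by rw [hm]; field_simp
  have e₂ : thetaResidue x 5 2 = n * t₀ / 2 := by rw [hn]; field_simp
  have hm₀ : 0 ≤ m := by rw [hm]; positivity
  have hn₀ : 0 ≤ n := by rw [hn]; positivity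
  rw [e₁, e₂] at hsq hsext ⊢
  have hmn : m * n = √5 - 1 := by
    refine mul_left_cancel₀ (pow_ne_zero 2 p₀.ne') ?_
    linear_combination -hsq
  have hsum : m ^ 5 + n ^ 5 = 8 * (m * n) - 2 * (m * n) ^ 2 + (m * n) ^ 3 := by
    refine mul_left_cancel₀ (pow_ne_zero 6 p₀.ne') ?_
    linear_combination 32 * hsext
  have hadd : m ^ 5 + n ^ 5 = 20 * √5 - 36 := by
    rw [hsum, hmn]
    linear_combination (√5 - 5) * h5
  have hmul : m ^ 5 * n ^ 5 = (√5 - 1) ^ 5 := by rw [← mul_pow, hmn]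
  have hroots := fifth_root_pair_add hm₀ hn₀ (hadd.trans tan_sin_pi_div_five_add_and_mul.1.symm)
    (hmul.trans tan_sin_pi_div_five_add_and_mul.2.symm)
  rw [add_assoc 1, hroots]
  ring
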